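/- Fix a finite alphabet $\mathcal X$ with $|\mathcal X|=\alpha$; all logarithms are to base 2. The incremental (LZ78) parsing of a word $w$ over $\mathcal X$ splits it sequentially into phrases, each of which is the shortest string that has not yet occurred as a phrase, except that the last phrase may be incomplete; $c(w)$ denotes the total number of phrases, the last one included. For a word $w$ of length $m\ge1$ put $\rho_{LZ}(w)=\frac{c(w)\log c(w)}{m}$. Let $LZ(w)$ be the length of the binary LZ78 encoding of $w$, in which the $j$-th phrase is described by a pointer to an earlier phrase (or to the empty string) and its last letter, using $\lceil\log(j\alpha)\rceil$ bits. Call $\epsilon_1:\mathbb N\to\mathbb R$ a redundancy function if $LZ(w)\le c(w)\log c(w)+m\,\epsilon_1(m)$ for every $m$ and every $w\in\mathcal X^m$, and $\epsilon_1(m)\to0$ as $m\to\infty$. For $x^n=(x_1,\dots,x_n)\in\mathcal X^n$ with $n\ge 1$ and $1\le\ell\le n$ let $\hat H_{csw}(X^\ell)$ be the entropy of the empirical distribution of the $n$ cyclic windows of length $\ell$ of $x^n$ (indices modulo $n$). If $\ell$ divides $n$, let $\hat H_{nob}(X^\ell)$ be the entropy of the empirical distribution of the $n/\ell$ non-overlapping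 blocks $x_{i\ell+1}^{i\ell+\ell}$. Let $$\Delta_\ell(s,\alpha)=\frac1\ell\log\Big\{s^2\Big[1+\log\Big(1+\frac{\alpha^\ell}{s}\Big)\Big]\Big\}.$$ Redundancy functions exist. For every redundancy function $\epsilon_1$, every positive integer $k$, every positive integer multiple $n$ of $k$, every $x^n\in\mathcal X^n$ and every positive integer $\ell\le n$, $$\frac kn\sum_{i=0}^{n/k-1}\rho_{LZ}(x_{ik+1}^{ik+k})\ \ge\ \frac{\hat H_{csw}(X^\ell)}{\ell}-\Delta_\ell(\alpha^k,\alpha)-\frac{\ell\log\alpha}{n}-\frac{\alpha^\ell}{n}\log\frac n\ell-\epsilon_1(k),$$ and, for every positive integer $\ell$ that divides $n$, $$\frac kn\sum_{i=0}^{n/k-1}\rho_{LZ}(x_{ik+1}^{ik+k})\ \ge\ \frac{\hat H_{nob}(X^\ell)}{\ell}-\Delta_\ell(\alpha^k,\alpha)-\epsilon_1(k).$$ The redundancy terms are small for $n\gg\ell\gg k\gg1$: for fixed $\ell$ the terms $\frac{\ell\log\alpha}{n}$ and $\frac{\alpha^\ell}{n}\log\frac n\ell$ tend to $0$ as $n\to\infty$;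 for fixed $k$, $\Delta_\ell(\alpha^k,\alpha)\to0$ as $\ell\to\infty$; and $\epsilon_1(k)\to0$ as $k\to\infty$. -/

import Mathlib

open Filter Topology

/-- One step of the LZ78 incremental parsing. `dict` is the list of phrases found so far, in order,
and `cur` is the phrase in progress. Letters are appended to `cur` until it is not in `dict`; it is
then recorded as a new phrase. A nonempty phrase left over at the end of the input is recorded as
the final (incomplete) phrase, although it already occurs in `dict`. -/
def lzParseAux {X : Type*} [DecidableEq X] (dict : List (List X)) (cur : List X) :
    List X → List (List X)
  | [] => if cur = [] then dict else dict ++ [cur]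
  | a :: w =>
    if cur ++ [a] ∈ dict then lzParseAux dict (cur ++ [a]) w
    else lzParseAux (dict ++ [cur ++ [a]]) [] w

/-- The phrases of the LZ78 incremental parsing of a word, in order. -/
def lzParse {X : Type*} [DecidableEq X] (w : List X) : List (List X) :=
  lzParseAux [] [] w

/-- The number `c(w)` of phrases in the incremental parsing of `w`,
the final (possibly incomplete) phrase included. -/
def lzCount {X : Type*} [DecidableEq X] (w : List X) : ℕ :=
  (lzParse w).length

/-- The normalized LZ complexity `c(w) log₂ c(w) / |w|` of a word `w`. -/
noncomputable def lzComplexity {X : Type*} [DecidableEq X] (w : List X) : ℝ :=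
  (lzCount w : ℝ) * Real.logb 2 (lzCount w) / (w.length : ℝ)

/-- The `b` low-order bits of `m`. -/
def natToBits (b m : ℕ) : List Bool :=
  List.ofFn fun i : Fin b => m.testBit i

/-- The LZ78 codeword of the phrase `p` when the earlier phrases are `dict`. The phrase is a copy
of an earlier phrase (or of the empty word, which has index `0`) followed by one letter, and the
pair (index, letter) is written in binary with `⌈log₂ (j α)⌉` bits if `p` is the `j`-th phrase. -/
def lzEncodePhrase {X : Type*} [DecidableEq X] {α : ℕ} (e : X ≃ Fin α)
    (dict : List (List X)) (p : List X) : List Bool :=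
  match p.getLast? with
  | none => []
  | some a =>
    natToBits (Nat.clog 2 ((dict.length + 1) * α))
      ((([] :: dict).idxOf p.dropLast) * α + (e a : ℕ))

/-- The binary string which the LZ78 code produces for the word `w`; `e` numbers the letters. -/
def lzEncode {X : Type*} [DecidableEq X] {α : ℕ} (e : X ≃ Fin α) (w : List X) : List Bool :=
  (List.finRange (lzParse w).length).flatMap fun j : Fin (lzParse w).length =>
    lzEncodePhrase e ((lzParse w).take j) ((lzParse w).get j)

/-- The LZ78 code length `LZ(w)` in bits. -/
def lzLength {X : Type*} [DecidableEq X] {α : ℕ} (e : X ≃ Fin α) (w : List X) : ℕ :=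
  (lzEncode e w).length

/-- `ε` is a redundancy function of the LZ78 code: `LZ(w) ≤ c(w) log₂ c(w) + m ε(m)` for all words
`w` of all lengths `m`, and `ε(m) → 0`; `ε` depends on the length only. -/
def IsLZRedundancy {X : Type*} [DecidableEq X] {α : ℕ} (e : X ≃ Fin α) (ε : ℕ → ℝ) : Prop :=
  (∀ w : List X, (lzLength e w : ℝ) ≤
      (lzCount w : ℝ) * Real.logb 2 (lzCount w) + (w.length : ℝ) * ε w.length) ∧
    Tendsto ε atTop (𝓝 0)

/-- The window of length `d` of `x` which starts at the position `t` (positions count from `0`),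
read cyclically. It is an ordinary segment of `x` if `t + d ≤ n`. -/
def cyclicWindow {X : Type*} {n : ℕ} [NeZero n] (x : Fin n → X) (d t : ℕ) : Fin d → X :=
  fun j => x (Fin.ofNat n (t + j))

/-- The empirical distribution of the cyclic sliding windows of length `d`. -/
noncomputable def cswDist {X : Type*} [DecidableEq X] {n : ℕ} [NeZero n] (x : Fin n → X) (d : ℕ)
    (w : Fin d → X) : ℝ :=
  1 / (n : ℝ) * (((Finset.range n).filter fun i => cyclicWindow x d i = w).card : ℝ)

/-- The empirical distribution of the non-overlapping blocks of length `d` (for `d ∣ n`). -/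
noncomputable def nobDist {X : Type*} [DecidableEq X] {n : ℕ} [NeZero n] (x : Fin n → X) (d : ℕ)
    (w : Fin d → X) : ℝ :=
  (d : ℝ) / (n : ℝ) *
    (((Finset.range (n / d)).filter fun i => cyclicWindow x d (i * d) = w).card : ℝ)

/-- Shannon entropy, in bits, of a distribution on a finite set. -/
noncomputable def shannonEntropy {ι : Type*} [Fintype ι] (P : ι → ℝ) : ℝ :=
  -∑ w, P w * Real.logb 2 (P w)

/-- The average normalized LZ complexity of the non-overlapping `k`-blocks of `x` (for `k ∣ n`). -/
noncomputable def avgLZComplexity {X : Type*} [DecidableEq X] {n : ℕ} [NeZero n] (x : Fin n → X)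
    (k : ℕ) : ℝ :=
  (k : ℝ) / (n : ℝ) *
    ∑ i ∈ Finset.range (n / k), lzComplexity (List.ofFn (cyclicWindow x k (i * k)))

/-- `Δ_ℓ(s, α) = (1/ℓ) log₂ (s² (1 + log₂ (1 + α^ℓ / s)))`. -/
noncomputable def lzDelta (ℓ : ℕ) (s α : ℝ) : ℝ :=
  1 / (ℓ : ℝ) * Real.logb 2 (s ^ 2 * (1 + Real.logb 2 (1 + α ^ ℓ / s)))

/-! The engine is a Kraft inequality: on words of fixed length `k` the weights `2 ^ (-LZ v)` sum to
at most one (`sum_inv_two_pow_lzLength_le_one`), so they serve as a subprobability on `k`-blocks.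
Take a product of such blocks with a uniform final block, push it forward to the windows at a given
phase, and average over the `k` phases. The result is one subprobability `Q` on `ℓ`-windows for
which `-log Q` is at most `log (k α^k)` plus the LZ78 lengths of the blocks ending inside the window
(`exists_phase_free_window_weight`). By Gibbs' inequality the mean of this bound dominates the
empirical entropy. Over all cyclic windows each block is counted `ℓ` times in total; over
non-overlapping windows, once. In both cases `H / ℓ ≤ log (k α^k) / ℓ + (1/n) ∑ LZ(block)`. The
redundancy function turns code lengths into complexities, and `k ≤ α^k` puts the first term below
`Δ_ℓ(α^k, α)`. Both inequalities follow; the cyclic one even holds without its two extra terms,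
which are nonnegative. -/

/-! ### Lengths of the LZ78 code -/

/-- The number of bits which the LZ78 code spends on `c` phrases. -/
def lzBits (α c : ℕ) : ℕ := ∑ j ∈ Finset.range c, Nat.clog 2 ((j + 1) * α)

theorem lzBits_succ (α c : ℕ) : lzBits α (c + 1) = lzBits α c + Nat.clog 2 ((c + 1) * α) :=
  Finset.sum_range_succ _ _

theorem ne_nil_of_mem_lzParseAux {X : Type*} [DecidableEq X] (w : List X) :
    ∀ (dict : List (List X)) (cur : List X), (∀ p ∈ dict, p ≠ []) →
      ∀ p ∈ lzParseAux dict cur w, p ≠ [] := by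
  induction w with
  | nil =>
    intro dict cur h p hp
    rw [lzParseAux] at hp
    split_ifs at hp with hc
    · exact h p hp
    · rcases List.mem_append.1 hp with hp | hp
      · exact h p hp
      · rw [List.mem_singleton.1 hp]
        exact hc
  | cons a w ih =>
    intro dict cur h p hp
    rw [lzParseAux] at hp
    split_ifs at hp with hc
    · exact ih _ _ h p hp
    · refine ih _ _ (fun q hq => ?_) p hp
      rcases List.mem_append.1 hq with hq | hq
      · exact h q hq
      · rw [List.mem_singleton.1 hq]
        simp

theorem lzEncodePhrase_length {X : Type*} [DecidableEq X] {α : ℕ} (e : X ≃ Fin α)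
    (dict : List (List X)) {p : List X} (hp : p ≠ []) :
    (lzEncodePhrase e dict p).length = Nat.clog 2 ((dict.length + 1) * α) := by
  rw [lzEncodePhrase, List.getLast?_eq_some_getLast hp]
  simp [natToBits]

theorem lzLength_eq {X : Type*} [DecidableEq X] {α : ℕ} (e : X ≃ Fin α) (w : List X) :
    lzLength e w = lzBits α (lzCount w) := by
  rw [lzLength, lzEncode, List.length_flatMap, lzBits, lzCount, Finset.sum_range, Fin.sum_univ_def]
  congr 1
  refine List.map_congr_left fun j _ => ?_
  rw [lzEncodePhrase_length]
  · simp [List.length_take]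
  · exact ne_nil_of_mem_lzParseAux w [] [] (by simp) _ (List.get_mem _ _)

/-! ### The Kraft inequality for the LZ78 code on words of fixed length -/

/-- The phrases (the empty one included) that extend `cur`. -/
def dictExtensions {X : Type*} [DecidableEq X] (dict : List (List X)) (cur : List X) :
    Finset (List X) :=
  (insert [] dict.toFinset).filter fun q => cur <+: q

theorem card_dictExtensions_le {X : Type*} [DecidableEq X] (dict : List (List X))
    (cur : List X) : (dictExtensions dict cur).card ≤ dict.length + 1 :=
  (Finset.card_filter_le _ _).trans <| (Finset.card_insert_le _ _).trans <|
    Nat.add_le_add_right (List.toFinset_card_le _) 1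

/-- Extensions by different letters are disjoint, and `cur`, itself in the dictionary, lies in none
of them. This spare unit pays for the new phrases in the Kraft induction. -/
theorem sum_card_dictExtensions_lt {X : Type*} [Fintype X] [DecidableEq X]
    (dict : List (List X)) (cur : List X) (hcur : cur ∈ insert [] dict.toFinset) :
    ∑ a, (dictExtensions dict (cur ++ [a])).card + 1 ≤ (dictExtensions dict cur).card := by
  have hdisj : ∀ a ∈ (Finset.univ : Finset X), ∀ b ∈ (Finset.univ : Finset X), a ≠ b →
      Disjoint (dictExtensions dict (cur ++ [a])) (dictExtensions dict (cur ++ [b])) := by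
    intro a _ b _ hab
    rw [Finset.disjoint_left]
    intro q hqa hqb
    have h1 := (Finset.mem_filter.1 hqa).2
    have h2 := (Finset.mem_filter.1 hqb).2
    have h3 := (List.prefix_of_prefix_length_le h1 h2 (by simp)).eq_of_length (by simp)
    exact hab (by simpa using h3)
  rw [← Finset.card_biUnion hdisj]
  have hnot : cur ∉ Finset.univ.biUnion fun a => dictExtensions dict (cur ++ [a]) := by
    intro h
    obtain ⟨a, _, ha⟩ := Finset.mem_biUnion.1 h
    have := (Finset.mem_filter.1 ha).2.length_le
    simp at this
  rw [← Finset.card_insert_of_notMem hnot]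
  refine Finset.card_le_card fun q hq => ?_
  rcases Finset.mem_insert.1 hq with rfl | hq
  · exact Finset.mem_filter.2 ⟨hcur, List.prefix_rfl⟩
  · obtain ⟨a, _, ha⟩ := Finset.mem_biUnion.1 hq
    have ha := Finset.mem_filter.1 ha
    exact Finset.mem_filter.2 ⟨ha.1, (List.prefix_append _ _).trans ha.2⟩

theorem inv_two_pow_clog_mul_le (b : ℕ) : ((2 : ℝ)⁻¹) ^ Nat.clog 2 b * b ≤ 1 := by
  rw [inv_pow, inv_mul_le_iff₀ (by positivity), mul_one]
  exact_mod_cast Nat.le_pow_clog one_lt_two b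

theorem sum_ofFn_succ {X : Type*} [Fintype X] (m : ℕ) (f : List X → ℝ) :
    ∑ v : Fin (m + 1) → X, f (List.ofFn v) = ∑ a, ∑ v : Fin m → X, f (a :: List.ofFn v) := by
  rw [← (Fin.consEquiv fun _ : Fin (m + 1) => X).sum_comp, Fintype.sum_prod_type]
  simp [Fin.consEquiv, List.ofFn_succ]

/-- The factor `α * card` bounds the number of codewords available to the phrase in progress. A
letter that stays in the dictionary passes on the count for the longer prefix. A letter that
completes a phrase costs at most one unit, because the next phrase has at most `jα ≤ 2 ^ ⌈log (jα)⌉`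
codewords. Summing over letters uses `sum_card_dictExtensions_lt`. The side condition excludes an
exhausted input with no phrase in progress, where phrase `dict.length + 1` never appears. -/
theorem sum_inv_two_pow_lzBits_aux {X : Type*} [Fintype X] [DecidableEq X] (m : ℕ) :
    ∀ (dict : List (List X)) (cur : List X), cur ∈ insert [] dict.toFinset →
      (m ≠ 0 ∨ cur ≠ []) →
      ∑ v : Fin m → X, ((2 : ℝ)⁻¹) ^
          lzBits (Fintype.card X) (lzParseAux dict cur (List.ofFn v)).length ≤
        ((2 : ℝ)⁻¹) ^ lzBits (Fintype.card X) (dict.length + 1) *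
          (Fintype.card X * (dictExtensions dict cur).card) := by
  induction m with
  | zero =>
    intro dict cur hcur h
    have hne : cur ≠ [] := by simpa using h
    have hX : 1 ≤ Fintype.card X := by
      obtain ⟨a, _⟩ := List.exists_mem_of_ne_nil cur hne
      exact Fintype.card_pos_iff.2 ⟨a⟩
    have hD : 1 ≤ (dictExtensions dict cur).card :=
      Finset.card_pos.2 ⟨cur, Finset.mem_filter.2 ⟨hcur, List.prefix_rfl⟩⟩
    simp only [List.ofFn_zero, lzParseAux, hne, if_false, List.length_append,
      List.length_singleton, Finset.sum_const, Finset.card_univ, Fintype.card_unique, one_smul]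
    refine le_mul_of_one_le_right (by positivity) ?_
    exact_mod_cast Nat.mul_le_mul hX hD
  | succ m ih =>
    intro dict cur hcur _
    set q : ℝ := ((2 : ℝ)⁻¹) ^ lzBits (Fintype.card X) (dict.length + 1) with hq
    have hq0 : 0 ≤ q := by positivity
    rw [sum_ofFn_succ m fun w => ((2 : ℝ)⁻¹) ^
      lzBits (Fintype.card X) (lzParseAux dict cur w).length]
    have step : ∀ a : X, ∑ v : Fin m → X, ((2 : ℝ)⁻¹) ^
          lzBits (Fintype.card X) (lzParseAux dict cur (a :: List.ofFn v)).length ≤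
        q * (Fintype.card X * (dictExtensions dict (cur ++ [a])).card + 1) := by
      intro a
      simp only [lzParseAux]
      split_ifs with hc
      · refine (ih dict (cur ++ [a]) (by simp [hc]) (Or.inr (by simp))).trans ?_
        exact mul_le_mul_of_nonneg_left (by linarith) hq0
      · have hle : q ≤ q * (Fintype.card X * (dictExtensions dict (cur ++ [a])).card + 1) :=
          le_mul_of_one_le_right hq0 (by
            have : (0 : ℝ) ≤ Fintype.card X * (dictExtensions dict (cur ++ [a])).card := by
              positivity
            linarith)
        refine le_trans ?_ hle
        -- If the input ends exactly with the new phrase, the induction hypothesis does not apply,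
        -- but the sum is `q` itself.
        rcases Nat.eq_zero_or_pos m with rfl | hm
        · simp [lzParseAux, hq]
        · refine (ih (dict ++ [cur ++ [a]]) [] (by simp) (Or.inl hm.ne')).trans ?_
          rw [lzBits_succ, pow_add, List.length_append, List.length_singleton, ← hq, mul_assoc]
          refine mul_le_of_le_one_right hq0 ?_
          refine le_trans ?_ (inv_two_pow_clog_mul_le ((dict.length + 1 + 1) * Fintype.card X))
          refine mul_le_mul_of_nonneg_left ?_ (by positivity)
          have := card_dictExtensions_le (dict ++ [cur ++ [a]]) []
          rw [List.length_append, List.length_singleton] at this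
          rw [mul_comm]
          exact_mod_cast Nat.mul_le_mul_right _ this
    refine (Finset.sum_le_sum fun a _ => step a).trans ?_
    rw [← Finset.mul_sum]
    refine mul_le_mul_of_nonneg_left ?_ hq0
    rw [Finset.sum_add_distrib, ← Finset.mul_sum, Finset.sum_const, Finset.card_univ,
      nsmul_eq_mul, ← mul_add]
    refine mul_le_mul_of_nonneg_left ?_ (by positivity)
    exact_mod_cast sum_card_dictExtensions_lt dict cur hcur

/-- The Kraft inequality for the LZ78 code on words of length `k`. -/
theorem sum_inv_two_pow_lzLength_le_one {X : Type*} [Fintype X] [DecidableEq X] {α : ℕ}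
    (e : X ≃ Fin α) (k : ℕ) :
    ∑ v : Fin k → X, ((2 : ℝ)⁻¹) ^ lzLength e (List.ofFn v) ≤ 1 := by
  have hα : Fintype.card X = α := by simpa using Fintype.card_congr e
  simp only [lzLength_eq]
  rcases Nat.eq_zero_or_pos k with rfl | hk
  · simp [lzCount, lzParse, lzParseAux, lzBits]
  · subst hα
    refine (sum_inv_two_pow_lzBits_aux k [] [] (by simp) (Or.inl hk.ne')).trans ?_
    refine le_trans ?_ (inv_two_pow_clog_mul_le (1 * Fintype.card X))
    have h1 : lzBits (Fintype.card X) 1 = Nat.clog 2 (1 * Fintype.card X) := by simp [lzBits]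
    simp only [List.length_nil, zero_add, h1]
    refine mul_le_mul_of_nonneg_left ?_ (by positivity)
    have := card_dictExtensions_le ([] : List (List X)) []
    rw [mul_comm]
    exact_mod_cast Nat.mul_le_mul_right _ this

/-! ### Existence of redundancy functions -/

/-- Only the incomplete final phrase can repeat an earlier one; it is split off as `last`. -/
theorem exists_lzParseAux_eq {X : Type*} [DecidableEq X] (w : List X) :
    ∀ (dict : List (List X)) (cur : List X), dict.Nodup →
      ∃ d last : List (List X), lzParseAux dict cur w = d ++ last ∧ d.Nodup ∧ last.length ≤ 1 ∧
        (d.map List.length).sum ≤ (dict.map List.length).sum + cur.length + w.length := by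
  induction w with
  | nil =>
    intro dict cur h
    refine ⟨dict, if cur = [] then [] else [cur], ?_, h, ?_, ?_⟩
    · rw [lzParseAux]
      split_ifs <;> simp
    · split_ifs <;> simp
    · simp
  | cons a w ih =>
    intro dict cur h
    rw [lzParseAux]
    split_ifs with hc
    · obtain ⟨d, last, h1, h2, h3, h4⟩ := ih dict (cur ++ [a]) h
      refine ⟨d, last, h1, h2, h3, h4.trans ?_⟩
      simp only [List.length_append, List.length_cons, List.length_nil]
      omega
    · obtain ⟨d, last, h1, h2, h3, h4⟩ := ih (dict ++ [cur ++ [a]]) []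
        (h.append (List.nodup_singleton _) (by simpa using hc))
      refine ⟨d, last, h1, h2, h3, h4.trans ?_⟩
      simp only [List.length_append, List.length_cons, List.length_nil, List.map_append,
        List.sum_append, List.map_cons, List.map_nil, List.sum_cons, List.sum_nil]
      omega

/-- A phrase outside `F` is longer than `L` and pays for itself by its length; by distinctness at
most `F.card` phrases lie inside. -/
theorem mul_length_le_of_nodup {X : Type*} [DecidableEq X] (L : ℕ) (F : Finset (List X))
    (hF : ∀ p : List X, p.length ≤ L → p ∈ F) (d : List (List X)) (hd : d.Nodup) :
    L * d.length ≤ L * F.card + (d.map List.length).sum := by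
  have key : ∀ d : List (List X),
      L * d.length ≤ L * (d.filter (· ∈ F)).length + (d.map List.length).sum := by
    intro d
    induction d with
    | nil => simp
    | cons p d ih =>
      by_cases hp : p ∈ F
      · simp only [List.filter_cons, hp, decide_true, if_true, List.length_cons, List.map_cons,
          List.sum_cons, mul_add, mul_one]
        omega
      · have : L < p.length := by
          by_contra h
          exact hp (hF p (not_lt.1 h))
        simp only [List.filter_cons, hp, decide_false, List.length_cons, List.map_cons,
          List.sum_cons, mul_add, mul_one, Bool.false_eq_true, if_false]
        omega
  refine (key d).trans (Nat.add_le_add_right (Nat.mul_le_mul_left _ ?_) _)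
  rw [← List.toFinset_card_of_nodup (hd.filter _)]
  exact Finset.card_le_card fun p hp => by simpa using (List.mem_filter.1 (List.mem_toFinset.1 hp)).2

/-- The number of phrases is sublinear, uniformly over the words of a given length. -/
theorem exists_mul_lzCount_le (X : Type*) [Finite X] [DecidableEq X] (L : ℕ) :
    ∃ C : ℕ, ∀ w : List X, L * lzCount w ≤ C + w.length := by
  have hfin := List.finite_length_le X L
  refine ⟨L * hfin.toFinset.card + L, fun w => ?_⟩
  obtain ⟨d, last, h1, h2, h3, h4⟩ := exists_lzParseAux_eq w [] [] List.nodup_nil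
  have h5 := mul_length_le_of_nodup L hfin.toFinset (fun p hp => by simpa using hp) d h2
  rw [lzCount, lzParse, h1, List.length_append, mul_add]
  have h6 : L * last.length ≤ L := by simpa using Nat.mul_le_mul_left L h3
  simp at h4
  omega

/-- The largest number of phrases of a word of length `m`. -/
def lzMaxCount (X : Type*) [Fintype X] [DecidableEq X] (m : ℕ) : ℕ :=
  Finset.univ.sup fun v : Fin m → X => lzCount (List.ofFn v)

theorem lzCount_le_lzMaxCount {X : Type*} [Fintype X] [DecidableEq X] (w : List X) :
    lzCount w ≤ lzMaxCount X w.length := by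
  have := Finset.le_sup (f := fun v : Fin w.length → X => lzCount (List.ofFn v))
    (Finset.mem_univ w.get)
  simpa [lzMaxCount] using this

theorem tendsto_lzMaxCount_div (X : Type*) [Fintype X] [DecidableEq X] :
    Tendsto (fun m : ℕ => (lzMaxCount X m : ℝ) / m) atTop (𝓝 0) := by
  rw [Metric.tendsto_atTop]
  intro δ hδ
  -- Once `m > C`, the count `c` satisfies `L * c ≤ C + m < 2 * m < L * δ * m`.
  obtain ⟨L, hL⟩ := exists_nat_gt (2 / δ)
  have hL0 : (0 : ℝ) < L := lt_trans (by positivity) hL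
  obtain ⟨C, hC⟩ := exists_mul_lzCount_le X L
  refine ⟨C + 1, fun m hm => ?_⟩
  have hm0 : (0 : ℝ) < m := by exact_mod_cast (by omega : 0 < m)
  have hle : L * lzMaxCount X m ≤ C + m := by
    obtain h | ⟨v, _, hv⟩ := (Finset.univ : Finset (Fin m → X)).eq_empty_or_nonempty.imp id
      (fun h => Finset.exists_mem_eq_sup _ h fun v : Fin m → X => lzCount (List.ofFn v))
    · simp [lzMaxCount, h]
    · rw [lzMaxCount, hv]
      simpa using hC (List.ofFn v)
  have hle' : (L : ℝ) * lzMaxCount X m ≤ C + m := by exact_mod_cast hle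
  have hCm : (C : ℝ) < m := by exact_mod_cast hm
  rw [Real.dist_eq, sub_zero, abs_of_nonneg (by positivity), div_lt_iff₀ hm0]
  have h2 : 2 < L * δ := by rwa [div_lt_iff₀ hδ] at hL
  have : (L : ℝ) * lzMaxCount X m < L * (δ * m) := by nlinarith
  exact lt_of_mul_lt_mul_left this hL0.le

theorem clog_le_logb_add_one {b : ℕ} (hb : 0 < b) : (Nat.clog 2 b : ℝ) ≤ Real.logb 2 b + 1 := by
  rw [← Real.natCeil_logb_natCast 2 b]
  exact (Nat.ceil_lt_add_one (Real.logb_nonneg one_lt_two (by exact_mod_cast hb))).le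

theorem lzBits_le {α : ℕ} (hα : 0 < α) (c : ℕ) :
    (lzBits α c : ℝ) ≤ c * Real.logb 2 c + c * (Real.logb 2 α + 1) := by
  rcases Nat.eq_zero_or_pos c with rfl | hc
  · simp [lzBits]
  have h : ∀ j ∈ Finset.range c,
      (Nat.clog 2 ((j + 1) * α) : ℝ) ≤ Real.logb 2 c + (Real.logb 2 α + 1) := by
    intro j hj
    have h1 : Nat.clog 2 ((j + 1) * α) ≤ Nat.clog 2 (c * α) :=
      Nat.clog_mono_right 2 (Nat.mul_le_mul_right _ (Finset.mem_range.1 hj))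
    have h2 := clog_le_logb_add_one (Nat.mul_pos hc hα)
    rw [Nat.cast_mul, Real.logb_mul (by positivity) (by positivity)] at h2
    have h3 : (Nat.clog 2 ((j + 1) * α) : ℝ) ≤ Nat.clog 2 (c * α) := by exact_mod_cast h1
    linarith
  have := Finset.sum_le_sum h
  rw [Finset.sum_const, Finset.card_range, nsmul_eq_mul] at this
  rw [lzBits, Nat.cast_sum]
  linarith

theorem exists_isLZRedundancy {X : Type*} [Fintype X] [DecidableEq X] {α : ℕ} (e : X ≃ Fin α) :
    ∃ ε : ℕ → ℝ, IsLZRedundancy e ε := by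
  -- The letter and the rounding cost at most `log α + 1` bits per phrase; the maximal phrase count
  -- makes the bound depend on the length only.
  refine ⟨fun m => (Real.logb 2 α + 1) * ((lzMaxCount X m : ℝ) / m), fun w => ?_, ?_⟩
  · rcases eq_or_ne w [] with rfl | hw
    · simp [lzLength_eq, lzCount, lzParse, lzParseAux, lzBits]
    · obtain ⟨a, _⟩ := List.exists_mem_of_ne_nil w hw
      have hα : 0 < α := (Nat.zero_le _).trans_lt (e a).2
      have hm : (0 : ℝ) < w.length := by exact_mod_cast List.length_pos_iff.2 hw
      have hc : (lzCount w : ℝ) ≤ lzMaxCount X w.length := by exact_mod_cast lzCount_le_lzMaxCount w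
      have hlog : 0 ≤ Real.logb 2 α := Real.logb_nonneg one_lt_two (by exact_mod_cast hα)
      have h := lzBits_le hα (lzCount w)
      rw [lzLength_eq]
      have h2 : (w.length : ℝ) * ((Real.logb 2 α + 1) * ((lzMaxCount X w.length : ℝ) / w.length)) =
          lzMaxCount X w.length * (Real.logb 2 α + 1) := by
        field_simp
      rw [h2]
      nlinarith
  · simpa using (tendsto_lzMaxCount_div X).const_mul (Real.logb 2 α + 1)

/-! ### Cross-entropy bounds -/

/-- Gibbs' inequality: the cross-entropy with respect to a subprobability bounds the entropy. -/
theorem shannonEntropy_le_crossEntropy {ι : Type*} [Fintype ι] {P Q : ι → ℝ}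
    (hP : ∀ w, 0 ≤ P w) (hP1 : ∑ w, P w = 1) (hQ : ∀ w, 0 ≤ Q w) (hQ1 : ∑ w, Q w ≤ 1)
    (hPQ : ∀ w, 0 < P w → 0 < Q w) :
    shannonEntropy P ≤ ∑ w, P w * -Real.logb 2 (Q w) := by
  have h : ∀ w ∈ (Finset.univ : Finset ι),
      P w * Real.log (Q w) - P w * Real.log (P w) ≤ Q w - P w := by
    intro w _
    rcases (hP w).eq_or_lt with h0 | h0
    · simpa [← h0] using hQ w
    · have hq := hPQ w h0
      have h1 := Real.log_le_sub_one_of_pos (div_pos hq h0)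
      rw [Real.log_div hq.ne' h0.ne'] at h1
      have h2 := mul_le_mul_of_nonneg_left h1 h0.le
      have h3 : P w * (Q w / P w - 1) = Q w - P w := by field_simp
      linarith
  have hs := Finset.sum_le_sum h
  rw [Finset.sum_sub_distrib, Finset.sum_sub_distrib, hP1] at hs
  have hl : 0 < Real.log 2 := Real.log_pos one_lt_two
  have e1 : ∑ w, P w * Real.logb 2 (P w) = (∑ w, P w * Real.log (P w)) / Real.log 2 := by
    rw [Finset.sum_div]
    exact Finset.sum_congr rfl fun w _ => by rw [Real.logb, mul_div_assoc]
  have e2 : ∑ w, P w * -Real.logb 2 (Q w) = -((∑ w, P w * Real.log (Q w)) / Real.log 2) := by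
    rw [Finset.sum_div, ← Finset.sum_neg_distrib]
    exact Finset.sum_congr rfl fun w _ => by rw [Real.logb, mul_neg, mul_div_assoc]
  rw [shannonEntropy, e1, e2]
  refine neg_le_neg (div_le_div_of_nonneg_right ?_ hl.le)
  linarith

theorem sum_empirical_mul {τ ι : Type*} [Fintype ι] [DecidableEq ι] (T : Finset τ) (W : τ → ι)
    (g : ι → ℝ) :
    ∑ w, (1 / (T.card : ℝ) * ((T.filter fun t => W t = w).card : ℝ)) * g w =
      1 / (T.card : ℝ) * ∑ t ∈ T, g (W t) := by
  rw [← Finset.sum_fiberwise T W fun t => g (W t), Finset.mul_sum]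
  refine Finset.sum_congr rfl fun w _ => ?_
  rw [mul_assoc, Finset.sum_congr rfl (g := fun _ => g w)
    fun t ht => by rw [(Finset.mem_filter.1 ht).2], Finset.sum_const, nsmul_eq_mul]

/-- The entropy of an empirical distribution is bounded by the mean code length. -/
theorem shannonEntropy_empirical_le {τ ι : Type*} [Fintype ι] [DecidableEq ι] {T : Finset τ}
    (hT : T.Nonempty) (W : τ → ι) {Q : ι → ℝ} (hQ : ∀ w, 0 ≤ Q w) (hQ1 : ∑ w, Q w ≤ 1)
    {b : τ → ℝ} (hb : ∀ t ∈ T, (2 : ℝ) ^ (-b t) ≤ Q (W t)) :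
    shannonEntropy (fun w => 1 / (T.card : ℝ) * ((T.filter fun t => W t = w).card : ℝ)) ≤
      1 / (T.card : ℝ) * ∑ t ∈ T, b t := by
  have hc : (0 : ℝ) < T.card := by exact_mod_cast hT.card_pos
  have hpos : ∀ t ∈ T, 0 < Q (W t) := fun t ht =>
    (Real.rpow_pos_of_pos two_pos _).trans_le (hb t ht)
  refine (shannonEntropy_le_crossEntropy (Q := Q) (fun w => by positivity) ?_ hQ hQ1 ?_).trans ?_
  · have := sum_empirical_mul T W fun _ => 1
    simp only [mul_one, Finset.sum_const, nsmul_eq_mul] at this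
    rw [this, one_div_mul_cancel hc.ne']
  · intro w hw
    have : (T.filter fun t => W t = w).Nonempty := by
      rw [← Finset.card_pos, Nat.pos_iff_ne_zero]
      intro h0
      simp [h0] at hw
    obtain ⟨t, ht⟩ := this
    have ht := Finset.mem_filter.1 ht
    exact ht.2 ▸ hpos t ht.1
  · rw [sum_empirical_mul T W fun w => -Real.logb 2 (Q w)]
    refine mul_le_mul_of_nonneg_left (Finset.sum_le_sum fun t ht => ?_) (by positivity)
    rw [neg_le, Real.le_logb_iff_rpow_le one_lt_two (hpos t ht)]
    exact hb t ht

/-! ### Window measures induced by block weights -/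

/-- The window of length `d` at the position `r` of the concatenation of `m + 1` blocks. -/
def blockWindow {X : Type*} {k m : ℕ} (hk : 0 < k) (d r : ℕ) (B : Fin (m + 1) → Fin k → X) :
    Fin d → X :=
  fun i => B (Fin.ofNat (m + 1) ((r + i) / k)) ⟨(r + i) % k, Nat.mod_lt _ hk⟩

theorem blockWindow_blocks {X : Type*} {k : ℕ} (hk : 0 < k) (d r : ℕ) (y : ℕ → X) :
    blockWindow (m := (r + d) / k) hk d r (fun j i => y (j * k + i)) =
      fun i : Fin d => y (r + i) := by
  funext i
  have h : (r + i) / k < (r + d) / k + 1 :=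
    Nat.lt_succ_of_le (Nat.div_le_div_right (by omega))
  simp only [blockWindow, Fin.val_ofNat, Nat.mod_eq_of_lt h]
  rw [Nat.div_add_mod']

/-- Block weights of total mass at most one induce a subprobability on windows, under which the
weight of a window at the offset `r` is at least the product of the weights of the blocks that
end inside the window, times the uniform weight of the last block. -/
theorem exists_window_weight {X : Type*} [Fintype X] [DecidableEq X] [Nonempty X] {k : ℕ}
    (hk : 0 < k) {q : (Fin k → X) → ℝ} (hq : ∀ v, 0 ≤ q v) (hq1 : ∑ v, q v ≤ 1) (d r : ℕ) :
    ∃ Q : (Fin d → X) → ℝ, (∀ w, 0 ≤ Q w) ∧ ∑ w, Q w ≤ 1 ∧ ∀ y : ℕ → X,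
      (∏ j ∈ Finset.range ((r + d) / k), q fun i => y (j * k + i)) *
        ((Fintype.card X : ℝ) ^ k)⁻¹ ≤ Q fun i => y (r + i) := by
  set m := (r + d) / k with hm
  -- Blocks below `m` end inside the window or at its right edge, though block `0` may start to its
  -- left. Block `m` is cut off by the right edge, so it gets uniform weight, at a cost of `k log α`
  -- bits.
  let p : Fin (m + 1) → (Fin k → X) → ℝ := fun j v =>
    if (j : ℕ) < m then q v else ((Fintype.card X : ℝ) ^ k)⁻¹
  have hp : ∀ j v, 0 ≤ p j v := by
    intro j v
    simp only [p]
    split_ifs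
    · exact hq v
    · positivity
  have hp1 : ∀ j, ∑ v, p j v ≤ 1 := by
    intro j
    simp only [p]
    split_ifs
    · exact hq1
    · have : (Fintype.card X : ℝ) ≠ 0 := by exact_mod_cast Fintype.card_ne_zero
      simp [this]
  -- The pushforward of the product measure along `blockWindow`. The lower bound keeps only the term
  -- of the actual blocks of `y`.
  refine ⟨fun w => ∑ B ∈ Finset.univ.filter
    fun B : Fin (m + 1) → Fin k → X => blockWindow hk d r B = w, ∏ j, p j (B j), ?_, ?_, ?_⟩
  · exact fun w => Finset.sum_nonneg fun B _ => Finset.prod_nonneg fun j _ => hp j _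
  · rw [Finset.sum_fiberwise, ← Fintype.prod_sum]
    exact Finset.prod_le_one (fun j _ => Finset.sum_nonneg fun v _ => hp j v) fun j _ => hp1 j
  · intro y
    refine le_trans (le_of_eq ?_) (Finset.single_le_sum
      (fun B _ => Finset.prod_nonneg fun j _ => hp j _)
      (Finset.mem_filter.2 ⟨Finset.mem_univ _, blockWindow_blocks hk d r y⟩))
    rw [Fin.prod_univ_castSucc, Finset.prod_range]
    simp [p]

/-- The mean over the phases `r < k` of the window weights gives one subprobability for all
positions. -/
theorem exists_phase_free_window_weight {X : Type*} [Fintype X] [DecidableEq X] [Nonempty X]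
    {k : ℕ} (hk : 0 < k) {q : (Fin k → X) → ℝ} (hq : ∀ v, 0 ≤ q v) (hq1 : ∑ v, q v ≤ 1)
    (d : ℕ) :
    ∃ Q : (Fin d → X) → ℝ, (∀ w, 0 ≤ Q w) ∧ ∑ w, Q w ≤ 1 ∧ ∀ (y : ℕ → X) (t : ℕ),
      (k : ℝ)⁻¹ * ((∏ j ∈ Finset.Ico (t / k) ((t + d) / k), q fun i => y (j * k + i)) *
        ((Fintype.card X : ℝ) ^ k)⁻¹) ≤ Q fun i => y (t + i) := by
  choose Q h0 h1 h2 using exists_window_weight (X := X) hk hq hq1 d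
  have hk' : (0 : ℝ) < k := by exact_mod_cast hk
  refine ⟨fun w => (k : ℝ)⁻¹ * ∑ r ∈ Finset.range k, Q r w, fun w => ?_, ?_, fun y t => ?_⟩
  · exact mul_nonneg (by positivity) (Finset.sum_nonneg fun r _ => h0 r w)
  · rw [← Finset.mul_sum, Finset.sum_comm, inv_mul_le_iff₀ hk', mul_one]
    refine (Finset.sum_le_sum fun r _ => h1 r).trans ?_
    simp
  · refine mul_le_mul_of_nonneg_left ?_ (by positivity)
    have hdiv : (t + d) / k - t / k = (t % k + d) / k := by
      conv_lhs => rw [← Nat.mod_add_div t k, add_right_comm, Nat.add_mul_div_left _ _ hk]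
      rw [Nat.add_mul_div_left _ _ hk, Nat.mod_div_self, zero_add, Nat.add_sub_cancel]
    -- Shifting `y` to the start of the block containing `t` leaves only the phase `t % k`.
    have h := h2 (t % k) fun i => y (t / k * k + i)
    have hw : (fun i : Fin d => y (t / k * k + (t % k + i))) = fun i : Fin d => y (t + i) := by
      funext i
      rw [← add_assoc, Nat.div_add_mod']
    rw [hw] at h
    refine le_trans ?_ (Finset.single_le_sum (f := fun r => Q r fun i : Fin d => y (t + i))
      (fun r _ => h0 r _) (Finset.mem_range.2 (Nat.mod_lt t hk)))
    refine le_trans (le_of_eq ?_) h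
    rw [Finset.prod_Ico_eq_prod_range, hdiv]
    simp only [add_mul, add_assoc]

/-! ### Entropy of windows and LZ78 code length of blocks -/

/-- The LZ78 code length of the `j`-th block of length `k` of the periodic extension of `x`. -/
noncomputable def blockLZLength {X : Type*} [DecidableEq X] {α : ℕ} (e : X ≃ Fin α) {n : ℕ}
    [NeZero n] (x : Fin n → X) (k j : ℕ) : ℕ :=
  lzLength e (List.ofFn (cyclicWindow x k (j * k)))

/-- The arbitrary positions `pos` let one bound serve both cyclic and non-overlapping windows. The
summand `α ^ k * k` collects the uniform last block and the average over phases. -/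
theorem shannonEntropy_windows_le {X : Type*} [Fintype X] [DecidableEq X] {α : ℕ}
    (e : X ≃ Fin α) {k n : ℕ} [NeZero n] (hk : 0 < k) (x : Fin n → X) (d : ℕ) {T : Finset ℕ}
    (hT : T.Nonempty) (pos : ℕ → ℕ) :
    shannonEntropy (fun w => 1 / (T.card : ℝ) *
        ((T.filter fun t => cyclicWindow x d (pos t) = w).card : ℝ)) ≤
      Real.logb 2 ((α : ℝ) ^ k * k) + 1 / (T.card : ℝ) * ∑ t ∈ T,
        ∑ j ∈ Finset.Ico (pos t / k) ((pos t + d) / k), (blockLZLength e x k j : ℝ) := by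
  have : Nonempty X := ⟨x 0⟩
  have hcard : Fintype.card X = α := by simpa using Fintype.card_congr e
  have hα : (0 : ℝ) < α := by
    rw [← hcard]
    exact_mod_cast Fintype.card_pos
  have hk' : (0 : ℝ) < k := by exact_mod_cast hk
  have hc : (0 : ℝ) < T.card := by exact_mod_cast hT.card_pos
  obtain ⟨Q, h0, h1, h2⟩ := exists_phase_free_window_weight hk
    (q := fun v => ((2 : ℝ)⁻¹) ^ lzLength e (List.ofFn v)) (fun v => by positivity)
    (sum_inv_two_pow_lzLength_le_one e k) d
  refine (shannonEntropy_empirical_le hT (fun t => cyclicWindow x d (pos t)) h0 h1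
    (b := fun t => Real.logb 2 ((α : ℝ) ^ k * k) +
      ∑ j ∈ Finset.Ico (pos t / k) ((pos t + d) / k), (blockLZLength e x k j : ℝ))
    fun t _ => ?_).trans (le_of_eq ?_)
  · refine le_trans (le_of_eq ?_) (h2 (fun i => x (Fin.ofNat n i)) (pos t))
    rw [Finset.prod_pow_eq_pow_sum, neg_add, Real.rpow_add two_pos, Real.rpow_neg two_pos.le,
      Real.rpow_logb two_pos (by norm_num) (by positivity), Real.rpow_neg two_pos.le,
      ← Nat.cast_sum, Real.rpow_natCast, hcard, mul_inv, inv_pow]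
    simp only [blockLZLength]
    rw [mul_comm ((α : ℝ) ^ k)⁻¹, mul_assoc, mul_comm ((α : ℝ) ^ k)⁻¹]
    rfl
  · rw [Finset.sum_add_distrib, Finset.sum_const, nsmul_eq_mul, mul_add, ← mul_assoc,
      one_div_mul_cancel hc.ne', one_mul]

theorem blockLZLength_add_div {X : Type*} [DecidableEq X] {α : ℕ} (e : X ≃ Fin α) {k n : ℕ}
    [NeZero n] (hkn : k ∣ n) (x : Fin n → X) (j : ℕ) :
    blockLZLength e x k (n / k + j) = blockLZLength e x k j := by
  have : cyclicWindow x k ((n / k + j) * k) = cyclicWindow x k (j * k) := by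
    funext i
    rw [cyclicWindow, cyclicWindow, add_mul, Nat.div_mul_cancel hkn, add_assoc]
    congr 1
    ext
    simp
  rw [blockLZLength, blockLZLength, this]

/-- Split the sum of `C` over `n + d` terms after `n` and after `d` terms, and compare. It is
applied to the cumulative code length `C`, with `A` the total over one period. -/
theorem sum_range_add_sub_of_quasiperiodic (C : ℕ → ℝ) (n d : ℕ) (A : ℝ)
    (hC : ∀ t, C (n + t) = A + C t) :
    ∑ t ∈ Finset.range n, (C (t + d) - C t) = d * A := by
  have h1 := Finset.sum_range_add C n d
  have h2 := Finset.sum_range_add C d n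
  rw [add_comm d n, h1] at h2
  simp only [hC, Finset.sum_add_distrib, Finset.sum_const, Finset.card_range, nsmul_eq_mul] at h2
  rw [Finset.sum_sub_distrib]
  simp only [add_comm _ d]
  linarith

theorem shannonEntropy_cswDist_le {X : Type*} [Fintype X] [DecidableEq X] {α : ℕ}
    (e : X ≃ Fin α) {k n : ℕ} [NeZero n] (hk : 0 < k) (hkn : k ∣ n) (x : Fin n → X) (d : ℕ) :
    shannonEntropy (cswDist x d) ≤ Real.logb 2 ((α : ℝ) ^ k * k) +
      (d : ℝ) / n * ∑ j ∈ Finset.range (n / k), (blockLZLength e x k j : ℝ) := by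
  have hn := NeZero.pos n
  have h := shannonEntropy_windows_le e hk x d (T := Finset.range n)
    (Finset.nonempty_range_iff.2 hn.ne') id
  rw [Finset.card_range] at h
  refine h.trans (le_of_eq ?_)
  set b : ℕ → ℝ := fun j => (blockLZLength e x k j : ℝ)
  have hs : ∑ t ∈ Finset.range n, ∑ j ∈ Finset.Ico (t / k) ((t + d) / k), b j =
      d * ∑ j ∈ Finset.range (n / k), b j := by
    rw [← sum_range_add_sub_of_quasiperiodic (fun t => ∑ j ∈ Finset.range (t / k), b j) n d]
    · exact Finset.sum_congr rfl fun t _ =>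
        Finset.sum_Ico_eq_sub _ (Nat.div_le_div_right (Nat.le_add_right t d))
    · intro t
      rw [Nat.add_div_of_dvd_right hkn, Finset.sum_range_add]
      simp only [b, blockLZLength_add_div e hkn]
  simp only [id]
  rw [hs]
  ring

theorem shannonEntropy_nobDist_le {X : Type*} [Fintype X] [DecidableEq X] {α : ℕ}
    (e : X ≃ Fin α) {k n : ℕ} [NeZero n] (hk : 0 < k) (x : Fin n → X) {d : ℕ} (hd : 0 < d)
    (hdn : d ∣ n) :
    shannonEntropy (nobDist x d) ≤ Real.logb 2 ((α : ℝ) ^ k * k) +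
      (d : ℝ) / n * ∑ j ∈ Finset.range (n / k), (blockLZLength e x k j : ℝ) := by
  have hn := NeZero.pos n
  have hpos : 0 < n / d := Nat.div_pos (Nat.le_of_dvd hn hdn) hd
  have h := shannonEntropy_windows_le e hk x d (T := Finset.range (n / d))
    (Finset.nonempty_range_iff.2 hpos.ne') (· * d)
  have hd0 : (d : ℝ) ≠ 0 := by exact_mod_cast hd.ne'
  rw [Finset.card_range, Nat.cast_div hdn hd0, one_div_div] at h
  refine h.trans (le_of_eq ?_)
  set b : ℕ → ℝ := fun j => (blockLZLength e x k j : ℝ)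
  have hs : ∑ i ∈ Finset.range (n / d), ∑ j ∈ Finset.Ico (i * d / k) ((i * d + d) / k), b j =
      ∑ j ∈ Finset.range (n / k), b j := by
    -- The windows tile the word, so the cumulative code lengths telescope, even if `d` is not a
    -- multiple of `k`.
    have := Finset.sum_range_sub (fun i => ∑ j ∈ Finset.range (i * d / k), b j) (n / d)
    simp only [zero_mul, Nat.zero_div, Finset.range_zero, Finset.sum_empty, sub_zero,
      Nat.div_mul_cancel hdn] at this
    rw [← this]
    refine Finset.sum_congr rfl fun i _ => ?_
    rw [Nat.add_one_mul, Finset.sum_Ico_eq_sub _ (Nat.div_le_div_right (Nat.le_add_right _ d))]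
  rw [hs]

/-! ### The lower bound on the mean LZ complexity -/

theorem sum_blockLZLength_le {X : Type*} [Fintype X] [DecidableEq X] {α : ℕ} (e : X ≃ Fin α)
    {ε : ℕ → ℝ} (hε : IsLZRedundancy e ε) {k n : ℕ} [NeZero n] (hk : 0 < k) (hkn : k ∣ n)
    (x : Fin n → X) :
    1 / (n : ℝ) * ∑ j ∈ Finset.range (n / k), (blockLZLength e x k j : ℝ) ≤
      avgLZComplexity x k + ε k := by
  have hn : (0 : ℝ) < n := by exact_mod_cast NeZero.pos n
  have hk' : (0 : ℝ) < k := by exact_mod_cast hk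
  have h : ∀ j ∈ Finset.range (n / k), (blockLZLength e x k j : ℝ) ≤
      k * lzComplexity (List.ofFn (cyclicWindow x k (j * k))) + k * ε k := by
    intro j _
    have := hε.1 (List.ofFn (cyclicWindow x k (j * k)))
    rw [List.length_ofFn] at this
    rw [lzComplexity, List.length_ofFn, mul_div_cancel₀ _ hk'.ne']
    exact this
  have hs := mul_le_mul_of_nonneg_left (Finset.sum_le_sum h) (one_div_nonneg.2 hn.le)
  refine hs.trans (le_of_eq ?_)
  rw [Finset.sum_add_distrib, ← Finset.mul_sum, Finset.sum_const, Finset.card_range, nsmul_eq_mul,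
    Nat.cast_div hkn hk'.ne', avgLZComplexity]
  field_simp

theorem shannonEntropy_of_subsingleton {ι : Type*} [Fintype ι] [Subsingleton ι] {P : ι → ℝ}
    (hP : ∑ w, P w = 1) : shannonEntropy P = 0 := by
  rw [shannonEntropy, neg_eq_zero]
  refine Finset.sum_eq_zero fun w _ => ?_
  have : P w = 1 := by rw [← hP, Fintype.sum_subsingleton _ w]
  simp [this]

theorem logb_pow_mul_le_lzDelta {α k ℓ : ℕ} (hα : 2 ≤ α) (hk : 0 < k) (hℓ : 0 < ℓ) :
    Real.logb 2 ((α : ℝ) ^ k * k) / ℓ ≤ lzDelta ℓ ((α : ℝ) ^ k) α := by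
  have hα' : (0 : ℝ) < α := by exact_mod_cast (by omega : 0 < α)
  have hk' : (0 : ℝ) < k := by exact_mod_cast hk
  have hkα : (k : ℝ) ≤ (α : ℝ) ^ k := by exact_mod_cast (Nat.lt_pow_self hα).le
  rw [lzDelta, div_eq_mul_one_div, mul_comm]
  refine mul_le_mul_of_nonneg_left ?_ (by positivity)
  refine Real.logb_le_logb_of_le one_lt_two (by positivity) ?_
  have h1 : (0 : ℝ) ≤ Real.logb 2 (1 + (α : ℝ) ^ ℓ / (α : ℝ) ^ k) :=
    Real.logb_nonneg one_lt_two (le_add_of_nonneg_right (by positivity))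
  rw [sq]
  calc (α : ℝ) ^ k * k ≤ (α : ℝ) ^ k * (α : ℝ) ^ k := by gcongr
    _ ≤ _ := le_mul_of_one_le_right (by positivity) (by linarith)

theorem one_le_sq_mul_one_add_logb {α : ℕ} (hα : 0 < α) (k ℓ : ℕ) :
    1 ≤ ((α : ℝ) ^ k) ^ 2 * (1 + Real.logb 2 (1 + (α : ℝ) ^ ℓ / (α : ℝ) ^ k)) := by
  have hα' : (1 : ℝ) ≤ α := by exact_mod_cast hα
  have h1 : (0 : ℝ) ≤ Real.logb 2 (1 + (α : ℝ) ^ ℓ / (α : ℝ) ^ k) :=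
    Real.logb_nonneg one_lt_two (le_add_of_nonneg_right (by positivity))
  exact one_le_mul_of_one_le_of_one_le (one_le_pow₀ (one_le_pow₀ hα')) (by linarith)

theorem lzDelta_nonneg {α : ℕ} (hα : 0 < α) (k ℓ : ℕ) : 0 ≤ lzDelta ℓ ((α : ℝ) ^ k) α :=
  mul_nonneg (by positivity) (Real.logb_nonneg one_lt_two (one_le_sq_mul_one_add_logb hα k ℓ))

theorem avgLZComplexity_ge_of_entropy_le {X : Type*} [Fintype X] [DecidableEq X] {α : ℕ}
    (e : X ≃ Fin α) {ε : ℕ → ℝ} (hε : IsLZRedundancy e ε) {k n : ℕ} [NeZero n] (hk : 0 < k)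
    (hkn : k ∣ n) (x : Fin n → X) {ℓ : ℕ} (hℓ : 0 < ℓ) {P : (Fin ℓ → X) → ℝ}
    (hP1 : ∑ w, P w = 1)
    (hP : shannonEntropy P ≤ Real.logb 2 ((α : ℝ) ^ k * k) +
      (ℓ : ℝ) / n * ∑ j ∈ Finset.range (n / k), (blockLZLength e x k j : ℝ)) :
    shannonEntropy P / ℓ - lzDelta ℓ ((α : ℝ) ^ k) α - ε k ≤ avgLZComplexity x k := by
  have hα : 0 < α := (Nat.zero_le _).trans_lt (e (x 0)).2
  have hℓ' : (0 : ℝ) < ℓ := by exact_mod_cast hℓ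
  have hsum := sum_blockLZLength_le e hε hk hkn x
  set S := ∑ j ∈ Finset.range (n / k), (blockLZLength e x k j : ℝ) with hS
  have hbound : shannonEntropy P / ℓ ≤ lzDelta ℓ ((α : ℝ) ^ k) α + 1 / (n : ℝ) * S := by
    -- For `α = 1` the estimate `k ≤ α ^ k` can fail, but then the entropy vanishes.
    rcases (Nat.succ_le_iff.2 hα).eq_or_lt with h1 | h2
    · have : Subsingleton X := by
        refine Fintype.card_le_one_iff_subsingleton.1 ?_
        simpa [← h1] using (Fintype.card_congr e).le
      rw [shannonEntropy_of_subsingleton hP1, zero_div]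
      have hS0 : 0 ≤ S := Finset.sum_nonneg fun j _ => Nat.cast_nonneg _
      exact add_nonneg (lzDelta_nonneg hα k ℓ) (by positivity)
    · have h3 := div_le_div_of_nonneg_right hP hℓ'.le
      have h4 := logb_pow_mul_le_lzDelta (k := k) h2 hk hℓ
      have h5 : (Real.logb 2 ((α : ℝ) ^ k * k) + (ℓ : ℝ) / n * S) / ℓ =
          Real.logb 2 ((α : ℝ) ^ k * k) / ℓ + 1 / (n : ℝ) * S := by
        field_simp
      linarith
  linarith

theorem sum_cswDist {X : Type*} [Fintype X] [DecidableEq X] {n : ℕ} [NeZero n] (x : Fin n → X)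
    (d : ℕ) : ∑ w, cswDist x d w = 1 := by
  have hn : (n : ℝ) ≠ 0 := by exact_mod_cast NeZero.ne n
  have h := sum_empirical_mul (Finset.range n) (fun i => cyclicWindow x d i) fun _ => 1
  simp only [mul_one, Finset.sum_const, nsmul_eq_mul, Finset.card_range,
    one_div_mul_cancel hn] at h
  exact h

theorem sum_nobDist {X : Type*} [Fintype X] [DecidableEq X] {n : ℕ} [NeZero n] (x : Fin n → X)
    {d : ℕ} (hd : 0 < d) (hdn : d ∣ n) : ∑ w, nobDist x d w = 1 := by
  have hn : (n : ℝ) ≠ 0 := by exact_mod_cast NeZero.ne n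
  have hd0 : (d : ℝ) ≠ 0 := by exact_mod_cast hd.ne'
  have h := sum_empirical_mul (Finset.range (n / d)) (fun i => cyclicWindow x d (i * d)) fun _ => 1
  simp only [mul_one, Finset.sum_const, nsmul_eq_mul, Finset.card_range, Nat.cast_div hdn hd0,
    one_div_div, div_mul_div_cancel₀ hn, div_self hd0] at h
  exact h

/-! ### The redundancy terms are small -/

theorem tendsto_logb_natCast_div (b : ℝ) :
    Tendsto (fun n : ℕ => Real.logb b n / n) atTop (𝓝 0) := by
  have h : Tendsto (fun n : ℕ => Real.log n / (n : ℝ)) atTop (𝓝 0) :=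
    (Real.isLittleO_log_id_atTop.tendsto_div_nhds_zero).comp tendsto_natCast_atTop_atTop
  have h2 := h.div_const (Real.log b)
  rw [zero_div] at h2
  refine h2.congr fun n => ?_
  rw [Real.logb, div_right_comm]

theorem tendsto_lzDelta (α k : ℕ) (hk : 0 < k) :
    Tendsto (fun ℓ : ℕ => lzDelta ℓ ((α : ℝ) ^ k) α) atTop (𝓝 0) := by
  rcases Nat.eq_zero_or_pos α with rfl | hα
  · simp [lzDelta, hk.ne']
  have hα' : (1 : ℝ) ≤ α := by exact_mod_cast hα
  have hlog : 0 ≤ Real.logb 2 α := Real.logb_nonneg one_lt_two hα'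
  set s : ℝ := (α : ℝ) ^ k with hs
  have hs1 : 1 ≤ s := one_le_pow₀ hα'
  -- For `ℓ ≥ 1`, `1 + (1 + ℓ log α) ≤ ℓ (2 + log α)`, so the argument of the logarithm is at most
  -- `C * ℓ`.
  set C : ℝ := s ^ 2 * (2 + Real.logb 2 α) with hC
  have hC0 : 0 < C := by positivity
  have hlim : Tendsto (fun ℓ : ℕ => Real.logb 2 C / (ℓ : ℝ) + Real.logb 2 ℓ / ℓ) atTop (𝓝 0) := by
    simpa using (tendsto_const_div_atTop_nhds_zero_nat (Real.logb 2 C)).add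
      (tendsto_logb_natCast_div 2)
  refine squeeze_zero' (Eventually.of_forall fun ℓ => lzDelta_nonneg hα k ℓ) ?_ hlim
  filter_upwards [eventually_ge_atTop 1] with ℓ hℓ
  have hℓ' : (1 : ℝ) ≤ ℓ := by exact_mod_cast hℓ
  have hone := one_le_sq_mul_one_add_logb hα k ℓ
  have hαℓ : (1 : ℝ) ≤ (α : ℝ) ^ ℓ := one_le_pow₀ hα'
  have h1 : Real.logb 2 (1 + (α : ℝ) ^ ℓ / s) ≤ 1 + ℓ * Real.logb 2 α := by
    calc Real.logb 2 (1 + (α : ℝ) ^ ℓ / s) ≤ Real.logb 2 (2 * (α : ℝ) ^ ℓ) := by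
          refine Real.logb_le_logb_of_le one_lt_two (by positivity) ?_
          have := div_le_self (by positivity : (0 : ℝ) ≤ (α : ℝ) ^ ℓ) hs1
          linarith
      _ = 1 + ℓ * Real.logb 2 α := by
          rw [Real.logb_mul two_ne_zero (by positivity), Real.logb_self_eq_one one_lt_two,
            Real.logb_pow]
  rw [← add_div, ← Real.logb_mul hC0.ne' (by positivity), lzDelta, one_div, div_eq_inv_mul _ (ℓ : ℝ)]
  refine mul_le_mul_of_nonneg_left ?_ (by positivity)
  refine Real.logb_le_logb_of_le one_lt_two (by linarith) ?_
  rw [hC, mul_assoc]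
  refine mul_le_mul_of_nonneg_left ?_ (by positivity)
  nlinarith

theorem tendsto_mul_logb_div (c : ℝ) {ℓ : ℕ} (hℓ : 0 < ℓ) :
    Tendsto (fun n : ℕ => c / (n : ℝ) * Real.logb 2 ((n : ℝ) / (ℓ : ℝ))) atTop (𝓝 0) := by
  have h := ((tendsto_logb_natCast_div 2).sub
    (tendsto_const_div_atTop_nhds_zero_nat (Real.logb 2 ℓ))).const_mul c
  rw [sub_zero, mul_zero] at h
  refine h.congr' ?_
  filter_upwards [eventually_gt_atTop 0] with n hn
  rw [Real.logb_div (Nat.cast_ne_zero.2 (ne_of_gt hn)) (Nat.cast_ne_zero.2 hℓ.ne')]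
  ring

theorem theorem1 {X : Type*} [Fintype X] [DecidableEq X] {α : ℕ} (e : X ≃ Fin α) :
    (∃ ε₁ : ℕ → ℝ, IsLZRedundancy e ε₁) ∧
    (∀ ε₁ : ℕ → ℝ, IsLZRedundancy e ε₁ →
      ∀ (k n : ℕ) [NeZero n], 0 < k → k ∣ n → ∀ (x : Fin n → X) (ℓ : ℕ), 0 < ℓ →
        (ℓ ≤ n →
          avgLZComplexity x k ≥
            shannonEntropy (cswDist x ℓ) / (ℓ : ℝ)
              - lzDelta ℓ ((α : ℝ) ^ k) (α : ℝ)
              - (ℓ : ℝ) * Real.logb 2 (α : ℝ) / (n : ℝ)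
              - (α : ℝ) ^ ℓ / (n : ℝ) * Real.logb 2 ((n : ℝ) / (ℓ : ℝ))
              - ε₁ k) ∧
        (ℓ ∣ n →
          avgLZComplexity x k ≥
            shannonEntropy (nobDist x ℓ) / (ℓ : ℝ)
              - lzDelta ℓ ((α : ℝ) ^ k) (α : ℝ)
              - ε₁ k)) ∧
    (∀ k : ℕ, 0 < k →
      Tendsto (fun ℓ : ℕ => lzDelta ℓ ((α : ℝ) ^ k) (α : ℝ)) atTop (𝓝 0)) ∧
    (∀ ℓ : ℕ, 0 < ℓ →
      Tendsto (fun n : ℕ => (ℓ : ℝ) * Real.logb 2 (α : ℝ) / (n : ℝ)) atTop (𝓝 0) ∧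
      Tendsto (fun n : ℕ => (α : ℝ) ^ ℓ / (n : ℝ) * Real.logb 2 ((n : ℝ) / (ℓ : ℝ)))
        atTop (𝓝 0)) := by
  refine ⟨exists_isLZRedundancy e, ?_, fun k hk => tendsto_lzDelta α k hk, fun ℓ hℓ =>
    ⟨tendsto_const_div_atTop_nhds_zero_nat _, tendsto_mul_logb_div _ hℓ⟩⟩
  intro ε hε k n _ hk hkn x ℓ hℓ
  refine ⟨fun hℓn => ?_, fun hdvd => ?_⟩
  · have h := avgLZComplexity_ge_of_entropy_le e hε hk hkn x hℓ (sum_cswDist x ℓ)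
      (shannonEntropy_cswDist_le e hk hkn x ℓ)
    have hα : (1 : ℝ) ≤ α := by exact_mod_cast Nat.one_le_iff_ne_zero.2 (Fin.pos (e (x 0))).ne'
    have h1 : 0 ≤ (ℓ : ℝ) * Real.logb 2 (α : ℝ) / (n : ℝ) :=
      div_nonneg (mul_nonneg (by positivity) (Real.logb_nonneg one_lt_two hα)) (by positivity)
    -- The bound `ℓ ≤ n` enters only here, to make the subtracted logarithm nonnegative.
    have h2 : 0 ≤ (α : ℝ) ^ ℓ / (n : ℝ) * Real.logb 2 ((n : ℝ) / (ℓ : ℝ)) := by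
      refine mul_nonneg (by positivity) (Real.logb_nonneg one_lt_two ?_)
      rw [one_le_div (by exact_mod_cast hℓ)]
      exact_mod_cast hℓn
    linarith
  · exact avgLZComplexity_ge_of_entropy_le e hε hk hkn x hℓ (sum_nobDist x hℓ hdvd)
      (shannonEntropy_nobDist_le e hk x hℓ hdvd)
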